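/- \textbf{Theorem (intrinsic presentation of function spaces).} Let $k$ be an infinite field, considered with the discrete topology. \emph{Definitions.} For a set $I$ and a collection $\mathcal F$ of subsets of $I$ put $\mathcal F^{\perp}=\{u'\subseteq I \mid u\cap u' \text{ is finite for all } u\in\mathcal F\}$. A finiteness space is a pair $X=(|X|,\mathcal F(X))$ of a set $|X|$ and a collection $\mathcal F(X)$ of subsets of $|X|$ with $\mathcal F(X)^{\perp\perp}=\mathcal F(X)$. The space $k\langle X\rangle$ consists of the families $x\in k^{|X|}$ whose support lies in $\mathcal F(X)$, with the linear topology in which the subspaces $\{x\mid \operatorname{supp}x\cap u'=\emptyset\}$, $u'\in\mathcal F(X)^{\perp}$, form a base of neighbourhoods of $0$; it is a Hausdorff linearly topologized vector space (ltvs). The finiteness space $X\multimap Y$ has underlying set $|X|\times|Y|$ and $\mathcal F(X\multimap Y)=\{u\times v'\mid u\in\mathcal F(X),\ v'\in\mathcal F(Y)^{\perp}\}^{\perp}$. The finiteness space $!X$ has as underlying set the finite multisets of elements of $|X|$, and a set $A$ of such multisets belongs to $\mathcal F(!X)$ iff $\bigcup_{m\in A}\operatorname{supp}m\in\mathcal F(X)$.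 A linear subspace $B$ of an ltvs $E$ is linearly bounded if its image in $E/U$ is finite dimensional for every open linear subspace $U$ of $E$. An $n$-linear map $f:E^n\to F$ between ltvs's is hypocontinuous if for every $i\in\{1,\dots,n\}$, every open linear subspace $V\subseteq F$ and all linearly bounded subspaces $B_j\subseteq E$ $(j\ne i)$ there is an open linear subspace $U\subseteq E$ such that $f(x_1,\dots,x_n)\in V$ whenever $x_i\in U$ and $x_j\in B_j$ for all $j\neq i$. A map $f:E\to F$ is polynomial if there are $n\in\mathbb N$ and hypocontinuous $i$-linear maps $f_i:E^i\to F$ $(0\le i\le n)$ with $f(x)=f_0+f_1(x)+\dots+f_n(x,\dots,x)$ for all $x\in E$. The vector space $\mathrm{Pol}(E,F)$ of polynomial maps carries the linear topology of uniform convergence on linearly bounded subspaces: the subspaces $\{f\mid f(B)\subseteq V\}$, with $B\subseteq E$ a linearly bounded subspace and $V\subseteq F$ an open linear subspace, form a base of neighbourhoods of $0$. Let $\mathrm{Ana}(E,F)$ be the completion of the ltvs $\mathrm{Pol}(E,F)$. \emph{Claim.} For all finiteness spaces $X$ and $Y$, the ltvs $k\langle\,!X\multimap Y\rangle$ is linearly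 homeomorphic to $\mathrm{Ana}(k\langle X\rangle,k\langle Y\rangle)$. -/

import Mathlib

universe u v w

/-! ### Linearly topologized vector spaces -/

section LinearTopologies

variable {K : Type u} [Field K] {E : Type v} [AddCommGroup E] [Module K E]

/-- The linear topology generated by a filter base `L` of linear subspaces of `E`:
`U` is open iff for every `x ∈ U` there is `V ∈ L` such that `x + V ⊆ U`. -/
abbrev linTopology (L : Set (Submodule K E)) (hne : L.Nonempty)
    (hdir : ∀ V₁ ∈ L, ∀ V₂ ∈ L, ∃ V ∈ L, V ≤ V₁ ⊓ V₂) : TopologicalSpace E where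
  IsOpen U := ∀ x ∈ U, ∃ V ∈ L, ∀ y ∈ V, x + y ∈ U
  isOpen_univ _ _ := by
    obtain ⟨V, hV⟩ := hne
    exact ⟨V, hV, fun _ _ => trivial⟩
  isOpen_inter U₁ U₂ h₁ h₂ x hx := by
    obtain ⟨V₁, hV₁, h₁⟩ := h₁ x hx.1
    obtain ⟨V₂, hV₂, h₂⟩ := h₂ x hx.2
    obtain ⟨V, hV, h⟩ := hdir V₁ hV₁ V₂ hV₂
    exact ⟨V, hV, fun y hy => ⟨h₁ y (h hy).1, h₂ y (h hy).2⟩⟩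
  isOpen_sUnion S hS x hx := by
    obtain ⟨U, hU, hxU⟩ := hx
    obtain ⟨V, hV, h⟩ := hS U hU x hxU
    exact ⟨V, hV, fun y hy => ⟨U, hU, h y hy⟩⟩

theorem linTopology_nhds_hasBasis (L : Set (Submodule K E)) (hne : L.Nonempty)
    (hdir : ∀ V₁ ∈ L, ∀ V₂ ∈ L, ∃ V ∈ L, V ≤ V₁ ⊓ V₂) (x : E) :
    (@nhds E (linTopology L hne hdir) x).HasBasis (fun V : Submodule K E => V ∈ L)
      (fun V => {z | z - x ∈ V}) := by
  let := linTopology L hne hdir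
  refine ⟨fun t => ?_⟩
  rw [mem_nhds_iff]
  constructor
  · rintro ⟨U, hUt, hU, hxU⟩
    obtain ⟨V, hV, h⟩ := hU x hxU
    exact ⟨V, hV, fun z hz => hUt (by simpa using h (z - x) hz)⟩
  · rintro ⟨V, hV, h⟩
    refine ⟨_, h, ?_, by simp⟩
    intro z hz
    refine ⟨V, hV, fun y hy => ?_⟩
    have : z + y - x = (z - x) + y := by abel
    simpa only [Set.mem_ofPred_eq, this] using V.add_mem hz hy

theorem linTopology_isTopologicalAddGroup (L : Set (Submodule K E)) (hne : L.Nonempty)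
    (hdir : ∀ V₁ ∈ L, ∀ V₂ ∈ L, ∃ V ∈ L, V ≤ V₁ ⊓ V₂) :
    @IsTopologicalAddGroup E (linTopology L hne hdir) _ := by
  let := linTopology L hne hdir
  have hb := linTopology_nhds_hasBasis L hne hdir
  refine @IsTopologicalAddGroup.mk E _ _ ⟨?_⟩ ⟨?_⟩
  · rw [continuous_iff_continuousAt]
    rintro ⟨a, b⟩
    refine (((hb a).prod_nhds (hb b)).tendsto_iff (hb _)).2 fun V hV => ⟨(V, V), ⟨hV, hV⟩, ?_⟩
    rintro ⟨p, q⟩ ⟨hp, hq⟩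
    have : p + q - (a + b) = (p - a) + (q - b) := by abel
    simpa only [Set.mem_ofPred_eq, this] using V.add_mem hp hq
  · rw [continuous_iff_continuousAt]
    intro a
    refine ((hb a).tendsto_iff (hb _)).2 fun V hV => ⟨V, hV, fun p hp => ?_⟩
    have : -p - -a = -(p - a) := by abel
    simpa only [Set.mem_ofPred_eq, this] using V.neg_mem hp

theorem linTopology_isLinearTopology (L : Set (Submodule K E)) (hne : L.Nonempty)
    (hdir : ∀ V₁ ∈ L, ∀ V₂ ∈ L, ∃ V ∈ L, V ≤ V₁ ⊓ V₂) :
    @IsLinearTopology K E _ _ _ (linTopology L hne hdir) := by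
  let := linTopology L hne hdir
  have hb := linTopology_nhds_hasBasis L hne hdir 0
  simp only [sub_zero] at hb
  exact IsLinearTopology.mk_of_hasBasis' (S := Submodule K E) (s := id) K hb
    fun s r _ hm => s.smul_mem r hm

theorem linTopology_continuousConstSMul (L : Set (Submodule K E)) (hne : L.Nonempty)
    (hdir : ∀ V₁ ∈ L, ∀ V₂ ∈ L, ∃ V ∈ L, V ≤ V₁ ⊓ V₂) :
    @ContinuousConstSMul K E (linTopology L hne hdir) _ := by
  let := linTopology L hne hdir
  have hb := linTopology_nhds_hasBasis L hne hdir
  refine ⟨fun c => continuous_iff_continuousAt.2 fun a => ?_⟩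
  refine ((hb a).tendsto_iff (hb _)).2 fun V hV => ⟨V, hV, fun p hp => ?_⟩
  simpa only [Set.mem_ofPred_eq, ← smul_sub] using V.smul_mem c hp

end LinearTopologies

/-! ### Linearly bounded subspaces, hypocontinuous multilinear maps, polynomial maps -/

section Polynomials

variable {K : Type u} [Field K]
  {E : Type v} [AddCommGroup E] [Module K E] [TopologicalSpace E]
  {F : Type w} [AddCommGroup F] [Module K F] [TopologicalSpace F]

/-- A linear subspace `B` is linearly bounded if its image in `E ⧸ U` is finite dimensional for
every open linear subspace `U`. -/
def LinBounded (B : Submodule K E) : Prop :=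
  ∀ U : Submodule K E, IsOpen (U : Set E) → FiniteDimensional K (B.map U.mkQ)

theorem LinBounded.bot : LinBounded (⊥ : Submodule K E) := fun U _ => by
  rw [Submodule.map_bot]; infer_instance

theorem LinBounded.sup {B₁ B₂ : Submodule K E} (h₁ : LinBounded B₁) (h₂ : LinBounded B₂) :
    LinBounded (B₁ ⊔ B₂) := fun U hU => by
  have := h₁ U hU
  have := h₂ U hU
  rw [Submodule.map_sup]; infer_instance

/-- Hypocontinuity of an `n`-linear map `f : E × ⋯ × E → F`. -/
def Hypocontinuous {n : ℕ} (f : MultilinearMap K (fun _ : Fin n => E) F) : Prop :=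
  ∀ (i : Fin n) (V : Submodule K F), IsOpen (V : Set F) →
    ∀ B : Fin n → Submodule K E, (∀ j, j ≠ i → LinBounded (B j)) →
      ∃ U : Submodule K E, IsOpen (U : Set E) ∧
        ∀ x : Fin n → E, x i ∈ U → (∀ j, j ≠ i → x j ∈ B j) → f x ∈ V

theorem Hypocontinuous.zero {n : ℕ} :
    Hypocontinuous (0 : MultilinearMap K (fun _ : Fin n => E) F) :=
  fun _ V _ _ _ => ⟨⊤, isOpen_univ, fun _ _ _ => V.zero_mem⟩

theorem Hypocontinuous.add {n : ℕ} {f g : MultilinearMap K (fun _ : Fin n => E) F}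
    (hf : Hypocontinuous f) (hg : Hypocontinuous g) : Hypocontinuous (f + g) := by
  intro i V hV B hB
  obtain ⟨U₁, hU₁, h₁⟩ := hf i V hV B hB
  obtain ⟨U₂, hU₂, h₂⟩ := hg i V hV B hB
  exact ⟨U₁ ⊓ U₂, hU₁.inter hU₂, fun x hx hxB =>
    V.add_mem (h₁ x hx.1 hxB) (h₂ x hx.2 hxB)⟩

theorem Hypocontinuous.smul {n : ℕ} {f : MultilinearMap K (fun _ : Fin n => E) F}
    (hf : Hypocontinuous f) (c : K) : Hypocontinuous (c • f) := by
  intro i V hV B hB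
  obtain ⟨U, hU, h⟩ := hf i V hV B hB
  exact ⟨U, hU, fun x hx hxB => V.smul_mem c (h x hx hxB)⟩

variable (K) in
/-- `f` is polynomial if `f x = f₀ + f₁ (x) + ⋯ + fₙ (x, …, x)` for some `n` and some
hypocontinuous `i`-linear maps `fᵢ`, `0 ≤ i ≤ n`. -/
def IsPolynomialMap (f : E → F) : Prop :=
  ∃ (n : ℕ) (g : (i : ℕ) → MultilinearMap K (fun _ : Fin i => E) F),
    (∀ i ≤ n, Hypocontinuous (g i)) ∧
      ∀ x, f x = ∑ i ∈ Finset.range (n + 1), g i (fun _ => x)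

theorem IsPolynomialMap.exists_of_le {f : E → F} {n : ℕ}
    {g : (i : ℕ) → MultilinearMap K (fun _ : Fin i => E) F}
    (hg : ∀ i ≤ n, Hypocontinuous (g i))
    (hf : ∀ x, f x = ∑ i ∈ Finset.range (n + 1), g i (fun _ => x)) {N : ℕ} (hN : n ≤ N) :
    ∃ g' : (i : ℕ) → MultilinearMap K (fun _ : Fin i => E) F, (∀ i, Hypocontinuous (g' i)) ∧
      ∀ x, f x = ∑ i ∈ Finset.range (N + 1), g' i (fun _ => x) := by
  refine ⟨fun i => if i ≤ n then g i else 0, fun i => ?_, fun x => ?_⟩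
  · by_cases hi : i ≤ n
    · simpa [hi] using hg i hi
    · simpa [hi] using Hypocontinuous.zero
  · rw [hf x]
    refine (Finset.sum_congr rfl fun i hi => ?_).trans (Finset.sum_subset
      (Finset.range_subset_range.2 (Nat.succ_le_succ hN)) fun i _ hi => ?_)
    · simp only [if_pos (Nat.lt_succ_iff.1 (Finset.mem_range.1 hi))]
    · simp only [if_neg fun h => hi (Finset.mem_range.2 (Nat.lt_succ_iff.2 h)),
        zero_apply]

variable (K E F) in
/-- The polynomial maps `E → F`, as a linear subspace of the space of all functions. -/
def polSubmodule : Submodule K (E → F) where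
  carrier := {f | IsPolynomialMap K f}
  zero_mem' := ⟨0, fun _ => 0, fun _ _ => Hypocontinuous.zero, fun _ => by simp⟩
  add_mem' := by
    rintro f f' ⟨n, g, hg, hf⟩ ⟨n', g', hg', hf'⟩
    obtain ⟨G, hG, hfG⟩ := IsPolynomialMap.exists_of_le hg hf (le_max_left n n')
    obtain ⟨G', hG', hfG'⟩ := IsPolynomialMap.exists_of_le hg' hf' (le_max_right n n')
    exact ⟨max n n', fun i => G i + G' i, fun i _ => (hG i).add (hG' i), fun x => by
      simp [hfG, hfG', Finset.sum_add_distrib]⟩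
  smul_mem' := by
    rintro c f ⟨n, g, hg, hf⟩
    exact ⟨n, fun i => c • g i, fun i hi => (hg i hi).smul c, fun x => by
      simp [hf, Finset.smul_sum]⟩

variable (K E F) in
/-- The space of polynomial maps `E → F`. -/
def Pol : Type (max v w) := polSubmodule K E F

namespace Pol

instance : AddCommGroup (Pol K E F) := inferInstanceAs (AddCommGroup (polSubmodule K E F))

instance : Module K (Pol K E F) := inferInstanceAs (Module K (polSubmodule K E F))

instance : CoeFun (Pol K E F) fun _ => E → F := ⟨fun f => f.1⟩

/-- `Ann(B, V) = {f | f(B) ⊆ V}`. -/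
def ann (B : Submodule K E) (V : Submodule K F) : Submodule K (Pol K E F) where
  carrier := {f | ∀ x ∈ B, f x ∈ V}
  zero_mem' _ _ := V.zero_mem
  add_mem' hf hg x hx := V.add_mem (hf x hx) (hg x hx)
  smul_mem' c _ hf x hx := V.smul_mem c (hf x hx)

variable (K E F) in
/-- The basic neighbourhoods of `0` for uniform convergence on linearly bounded subspaces. -/
def basis : Set (Submodule K (Pol K E F)) :=
  {W | ∃ (B : Submodule K E) (V : Submodule K F), LinBounded B ∧ IsOpen (V : Set F) ∧ W = ann B V}

theorem basis_nonempty : (basis K E F).Nonempty :=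
  ⟨_, ⊥, ⊤, LinBounded.bot, isOpen_univ, rfl⟩

theorem basis_directed :
    ∀ W₁ ∈ basis K E F, ∀ W₂ ∈ basis K E F, ∃ W ∈ basis K E F, W ≤ W₁ ⊓ W₂ := by
  rintro _ ⟨B₁, V₁, hB₁, hV₁, rfl⟩ _ ⟨B₂, V₂, hB₂, hV₂, rfl⟩
  exact ⟨_, ⟨B₁ ⊔ B₂, V₁ ⊓ V₂, hB₁.sup hB₂, hV₁.inter hV₂, rfl⟩, fun f hf =>
    ⟨fun x hx => (hf x (Submodule.mem_sup_left hx)).1,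
      fun x hx => (hf x (Submodule.mem_sup_right hx)).2⟩⟩

/-- The topology of uniform convergence on linearly bounded subspaces. -/
instance : TopologicalSpace (Pol K E F) := linTopology (basis K E F) basis_nonempty basis_directed

instance : IsTopologicalAddGroup (Pol K E F) :=
  linTopology_isTopologicalAddGroup _ basis_nonempty basis_directed

instance : IsLinearTopology K (Pol K E F) :=
  linTopology_isLinearTopology _ basis_nonempty basis_directed

instance : ContinuousConstSMul K (Pol K E F) :=
  linTopology_continuousConstSMul _ basis_nonempty basis_directed

/-- The uniform structure of the additive topological group `Pol K E F`. -/
instance : UniformSpace (Pol K E F) := IsTopologicalAddGroup.rightUniformSpace _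

instance : IsUniformAddGroup (Pol K E F) := isUniformAddGroup_of_addCommGroup

instance : UniformContinuousConstSMul K (Pol K E F) :=
  uniformContinuousConstSMul_of_continuousConstSMul K _

end Pol

variable (K E F) in
/-- The completion of the ltvs of polynomial maps. -/
abbrev Ana : Type (max v w) := UniformSpace.Completion (Pol K E F)

/-- The completion is again linearly topologized. -/
instance Ana.isLinearTopology : IsLinearTopology K (Ana K E F) := by
  have hb := (IsLinearTopology.hasBasis_submodule K (M := Pol K E F)).hasBasis_of_isDenseInducing
    UniformSpace.Completion.isDenseInducing_coe
  rw [UniformSpace.Completion.coe_zero] at hb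
  let ι : Pol K E F →ₗ[K] Ana K E F :=
    ⟨⟨fun f => f, UniformSpace.Completion.coe_add⟩, UniformSpace.Completion.coe_smul⟩
  exact IsLinearTopology.mk_of_hasBasis' (S := Submodule K (Ana K E F))
    (s := fun N : Submodule K (Pol K E F) => (N.map ι).topologicalClosure) K hb
    fun s r _ hm => s.smul_mem r hm

/-- The universal property of the completion: continuous linear maps into complete Hausdorff
spaces extend uniquely. -/
theorem Ana.existsUnique_extension {G : Type*} [AddCommGroup G] [Module K G] [UniformSpace G]
    [IsUniformAddGroup G] [ContinuousConstSMul K G] [CompleteSpace G] [T2Space G]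
    (g : Pol K E F →L[K] G) : ∃! g' : Ana K E F →L[K] G, ∀ f : Pol K E F, g' f = g f := by
  let φ := g.toLinearMap.toAddMonoidHom.extension g.continuous
  have hφ : Continuous φ := AddMonoidHom.continuous_extension _ g.continuous
  have hφc : ∀ f : Pol K E F, φ f = g f := fun f =>
    AddMonoidHom.extension_coe _ g.continuous f
  refine ⟨⟨⟨⟨φ, φ.map_add⟩, fun c x => ?_⟩, hφ⟩, hφc, fun g' hg' => ?_⟩
  · change φ (c • x) = c • φ x
    induction x using UniformSpace.Completion.induction_on with
    | hp => exact isClosed_eq (hφ.comp (continuous_const_smul c)) (hφ.const_smul c)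
    | ih f => rw [← UniformSpace.Completion.coe_smul, hφc, hφc, map_smul]
  · ext x
    change g' x = φ x
    induction x using UniformSpace.Completion.induction_on with
    | hp => exact isClosed_eq g'.continuous hφ
    | ih f => rw [hg', hφc]

end Polynomials

/-! ### Finiteness spaces -/

/-- The orthogonal `{u' | ∀ u ∈ 𝓕, u ∩ u' is finite}`. -/
def finOrth {I : Type u} (𝓕 : Set (Set I)) : Set (Set I) :=
  {u' | ∀ u ∈ 𝓕, (u ∩ u').Finite}

theorem subset_finOrth_finOrth {I : Type u} (𝓕 : Set (Set I)) : 𝓕 ⊆ finOrth (finOrth 𝓕) :=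
  fun u hu u' hu' => by rw [Set.inter_comm]; exact hu' u hu

theorem finOrth_finOrth_finOrth {I : Type u} (𝓕 : Set (Set I)) :
    finOrth (finOrth (finOrth 𝓕)) = finOrth 𝓕 :=
  Set.Subset.antisymm (fun _ hu' u hu => hu' u (subset_finOrth_finOrth 𝓕 hu))
    (subset_finOrth_finOrth _)

/-- A finiteness space: a set with a biorthogonally closed collection of (finitary) subsets. -/
structure FinitenessSpace where
  /-- the underlying set -/
  Web : Type u
  /-- the finitary subsets -/
  fin : Set (Set Web)
  finOrth_finOrth : finOrth (finOrth fin) = fin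

namespace FinitenessSpace

theorem mem_fin_iff (X : FinitenessSpace.{u}) {u : Set X.Web} :
    u ∈ X.fin ↔ ∀ u' ∈ finOrth X.fin, (u' ∩ u).Finite := by
  conv_lhs => rw [← X.finOrth_finOrth]
  rfl

theorem mem_fin_of_finite (X : FinitenessSpace.{u}) {u : Set X.Web} (h : u.Finite) : u ∈ X.fin :=
  X.mem_fin_iff.2 fun _ _ => h.inter_of_right _

theorem mem_fin_of_subset (X : FinitenessSpace.{u}) {u v : Set X.Web} (h : u ⊆ v)
    (hv : v ∈ X.fin) : u ∈ X.fin :=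
  X.mem_fin_iff.2 fun u' hu' => (X.mem_fin_iff.1 hv u' hu').subset (Set.inter_subset_inter_right _ h)

theorem union_mem_fin (X : FinitenessSpace.{u}) {u v : Set X.Web} (hu : u ∈ X.fin)
    (hv : v ∈ X.fin) : u ∪ v ∈ X.fin :=
  X.mem_fin_iff.2 fun u' hu' => by
    rw [Set.inter_union_distrib_left]
    exact (X.mem_fin_iff.1 hu u' hu').union (X.mem_fin_iff.1 hv u' hu')

/-- The orthogonal finiteness space. -/
def orth (X : FinitenessSpace.{u}) : FinitenessSpace.{u} :=
  ⟨X.Web, finOrth X.fin, finOrth_finOrth_finOrth _⟩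

/-- The linear function space `X ⊸ Y`. -/
def limpl (X : FinitenessSpace.{u}) (Y : FinitenessSpace.{v}) : FinitenessSpace.{max u v} where
  Web := X.Web × Y.Web
  fin := finOrth {w | ∃ u ∈ X.fin, ∃ v' ∈ finOrth Y.fin, w = u ×ˢ v'}
  finOrth_finOrth := finOrth_finOrth_finOrth _

/-- The exponential `!X`: its web is the set of finite multisets of elements of the web of `X`,
and a set of multisets is finitary iff the union of the supports is finitary in `X`. -/
def excl (X : FinitenessSpace.{u}) : FinitenessSpace.{u} where
  Web := Multiset X.Web
  fin := {A | (⋃ m ∈ A, {a | a ∈ m}) ∈ X.fin}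
  finOrth_finOrth := by
    refine Set.Subset.antisymm (fun A hA => ?_) (subset_finOrth_finOrth _)
    refine X.mem_fin_iff.2 fun u' hu' => ?_
    have hch : ∀ a : X.Web, ∃ m : Multiset X.Web,
        a ∈ u' ∩ (⋃ m ∈ A, {a | a ∈ m}) → m ∈ A ∧ a ∈ m := by
      intro a
      by_cases ha : a ∈ u' ∩ (⋃ m ∈ A, {a | a ∈ m})
      · obtain ⟨m, hm, ham⟩ := Set.mem_iUnion₂.1 ha.2
        exact ⟨m, fun _ => ⟨hm, ham⟩⟩
      · exact ⟨0, fun h => absurd h ha⟩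
    choose c hc using hch
    set s := u' ∩ (⋃ m ∈ A, {a | a ∈ m}) with hs
    have hA' : c '' s ∈ finOrth {A | (⋃ m ∈ A, {a | a ∈ m}) ∈ X.fin} := by
      intro U hU
      refine ((hu' _ hU).image c).subset ?_
      rintro _ ⟨hmU, a, ha, rfl⟩
      exact ⟨a, ⟨Set.mem_iUnion₂.2 ⟨c a, hmU, (hc a ha).2⟩, ha.1⟩, rfl⟩
    have hfin : (c '' s).Finite := (hA _ hA').subset fun m hm => by
      refine ⟨hm, ?_⟩
      obtain ⟨a, ha, rfl⟩ := hm
      exact (hc a ha).1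
    refine (hfin.biUnion fun m _ => m.finite_toSet).subset fun a ha => ?_
    exact Set.mem_iUnion₂.2 ⟨c a, ⟨a, ha, rfl⟩, (hc a ha).2⟩

section Vectors

variable (K : Type w) [Field K] (X : FinitenessSpace.{u})

/-- The families `x : Web X → K` whose support is finitary. -/
def vecSubmodule : Submodule K (X.Web → K) where
  carrier := {x | Function.support x ∈ X.fin}
  zero_mem' := X.mem_fin_of_finite (by simp)
  add_mem' hx hy := X.mem_fin_of_subset (Function.support_add _ _) (X.union_mem_fin hx hy)
  smul_mem' c x hx := X.mem_fin_of_subset (Function.support_const_smul_subset c x) hx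

/-- The space `K⟨X⟩`. -/
def Vec : Type (max u w) := vecSubmodule K X

namespace Vec

instance : AddCommGroup (Vec K X) := inferInstanceAs (AddCommGroup (vecSubmodule K X))

instance : Module K (Vec K X) := inferInstanceAs (Module K (vecSubmodule K X))

instance : CoeFun (Vec K X) fun _ => X.Web → K := ⟨fun x => x.1⟩

variable {X} in
/-- The subspace of the `x` in `K⟨X⟩` whose support does not meet `u'`. -/
def neigh (u' : Set X.Web) : Submodule K (Vec K X) where
  carrier := {x | Function.support x ∩ u' = ∅}
  zero_mem' := by
    change Function.support (0 : X.Web → K) ∩ u' = ∅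
    simp
  add_mem' {x y} hx hy := by
    refine Set.subset_empty_iff.1 ?_
    refine (Set.inter_subset_inter_left u' (Function.support_add x.1 y.1)).trans ?_
    rw [Set.union_inter_distrib_right]
    exact Set.union_subset hx.le hy.le
  smul_mem' c x hx := Set.subset_empty_iff.1
    ((Set.inter_subset_inter_left u' (Function.support_const_smul_subset c x.1)).trans hx.le)

/-- The basic neighbourhoods of `0` in `K⟨X⟩`. -/
def basis : Set (Submodule K (Vec K X)) := {W | ∃ u' ∈ finOrth X.fin, W = neigh K u'}

theorem basis_nonempty : (basis K X).Nonempty :=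
  ⟨_, ∅, X.orth.mem_fin_of_finite Set.finite_empty, rfl⟩

theorem basis_directed :
    ∀ W₁ ∈ basis K X, ∀ W₂ ∈ basis K X, ∃ W ∈ basis K X, W ≤ W₁ ⊓ W₂ := by
  rintro _ ⟨u', hu', rfl⟩ _ ⟨v', hv', rfl⟩
  refine ⟨_, ⟨u' ∪ v', X.orth.union_mem_fin hu' hv', rfl⟩, fun x hx => ⟨?_, ?_⟩⟩
  · exact Set.subset_empty_iff.1
      ((Set.inter_subset_inter_right _ Set.subset_union_left).trans (Eq.le hx))
  · exact Set.subset_empty_iff.1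
      ((Set.inter_subset_inter_right _ Set.subset_union_right).trans (Eq.le hx))

/-- The canonical topology of `K⟨X⟩`. -/
instance : TopologicalSpace (Vec K X) :=
  linTopology (basis K X) (basis_nonempty K X) (basis_directed K X)

instance : IsTopologicalAddGroup (Vec K X) :=
  linTopology_isTopologicalAddGroup _ (basis_nonempty K X) (basis_directed K X)

instance : IsLinearTopology K (Vec K X) :=
  linTopology_isLinearTopology _ (basis_nonempty K X) (basis_directed K X)

instance : ContinuousConstSMul K (Vec K X) :=
  linTopology_continuousConstSMul _ (basis_nonempty K X) (basis_directed K X)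

end Vec

end Vectors

end FinitenessSpace

/-! Let `D` be the space of finitely supported families indexed by pairs `(m, b)`, a finite multiset
`m` of points of `X` and a point `b` of `Y`. It sits densely in the complete Hausdorff space `K⟨!X ⊸
Y⟩`. It also maps to polynomial maps, sending the unit vector at `(m, b)` to `x ↦ x^m e_b`. If this
second map has dense range and induces the same topology on `D`, both `K⟨!X ⊸ Y⟩` and `Ana` are
completions of `D`, hence isomorphic.

Same topology (`comap_ofFinsupp_nhds_zero`): in both cases a base at `0` is given by pairs `u ∈
F(X)`, `v' ∈ F(Y)^⊥`, requiring the coefficients at `(m, b)` to vanish when `m` lives on `u` and `b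
∈ v'`. For `K⟨!X ⊸ Y⟩` this holds because such rectangles are cofinal in the orthogonal. For
polynomial maps it holds because the bounded subspaces are those supported in some finitary `u`, and
because over an infinite field a polynomial vanishing everywhere has zero coefficients.

Density (`denseRange_polOfFinsupp`): modulo an open subspace, a hypocontinuous multilinear map
restricted to the diagonal of a bounded subspace sees only finitely many coordinates. -/

open Filter Topology

/-! ### Completions of a common dense subspace -/

/-- If a vector space `D` maps linearly with dense image to a complete Hausdorff space `G` and to
`P`, and if both maps induce the same neighbourhoods of `0` on `D`, then `G` is a completion
of `P`. -/
theorem nonempty_continuousLinearEquiv_completion {K D G P : Type*} [Field K]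
    [AddCommGroup D] [Module K D]
    [AddCommGroup G] [Module K G] [UniformSpace G] [IsUniformAddGroup G] [ContinuousConstSMul K G]
    [CompleteSpace G] [T2Space G]
    [AddCommGroup P] [Module K P] [UniformSpace P] [IsUniformAddGroup P]
    [UniformContinuousConstSMul K P]
    (i : D →ₗ[K] G) (p : D →ₗ[K] P) (hi : DenseRange i) (hp : DenseRange p)
    (h : comap i (𝓝 0) = comap p (𝓝 0)) :
    Nonempty (G ≃L[K] UniformSpace.Completion P) := by
  -- `D` carries the uniformity pulled back from `G`, possibly non-separated; by `h` it is also the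
  -- one pulled back from `P`, so `G` and the completion of `P` both complete `D`.
  let uD : UniformSpace D := UniformSpace.comap i inferInstance
  have gD : IsUniformAddGroup D := IsUniformAddGroup.comap i
  have ui : IsUniformInducing i := ⟨rfl⟩
  have up : IsUniformInducing p := by
    refine ⟨?_⟩
    have h0 : 𝓝 (0 : D) = comap p (𝓝 0) := by
      rw [ui.isInducing.nhds_eq_comap 0, map_zero, h]
    simp [uniformity_eq_comap_nhds_zero, h0, comap_comap, Function.comp_def]
  let pkg : AbstractCompletion D :=
    ⟨G, i, inferInstance, inferInstance, inferInstance, ui, hi⟩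
  let pkg' : AbstractCompletion D :=
    ⟨UniformSpace.Completion P, fun d => p d, inferInstance, inferInstance, inferInstance,
      (UniformSpace.Completion.isUniformInducing_coe P).comp up,
      UniformSpace.Completion.denseRange_coe.comp hp (UniformSpace.Completion.continuous_coe P)⟩
  let e : G ≃ᵤ UniformSpace.Completion P := pkg.compareEquiv pkg'
  have he : ∀ d, e (i d) = (p d : UniformSpace.Completion P) := pkg.compare_coe pkg'
  -- Linearity of the comparison map holds on the image of `D` and extends by density.
  have hadd : ∀ x y, e (x + y) = e x + e y := by
    intro x y
    refine hi.induction_on₂ (p := fun x y => e (x + y) = e x + e y) ?_ ?_ x y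
    · exact isClosed_eq (e.continuous.comp continuous_add)
        ((e.continuous.comp continuous_fst).add (e.continuous.comp continuous_snd))
    · intro a b
      rw [← map_add, he, he, he, map_add, UniformSpace.Completion.coe_add]
  have hsmul : ∀ (c : K) x, e (c • x) = c • e x := by
    intro c x
    refine hi.induction_on (p := fun x => e (c • x) = c • e x) x ?_ ?_
    · exact isClosed_eq (e.continuous.comp (continuous_const_smul c))
        (e.continuous.const_smul c)
    · intro a
      rw [← map_smul, he, he, map_smul, UniformSpace.Completion.coe_smul]
  exact ⟨⟨{ e.toEquiv with map_add' := hadd, map_smul' := hsmul },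
    e.continuous, e.symm.continuous⟩⟩

/-! ### Cofinal families for `X ⊸ Y` and `!X` -/

namespace FinitenessSpace

theorem prod_mem_finOrth_limpl {X : FinitenessSpace.{u}} {Y : FinitenessSpace.{v}}
    {u : Set X.Web} {v' : Set Y.Web} (hu : u ∈ X.fin) (hv' : v' ∈ finOrth Y.fin) :
    u ×ˢ v' ∈ finOrth (X.limpl Y).fin :=
  subset_finOrth_finOrth _ ⟨u, hu, v', hv', rfl⟩

/-- Choose a section `c` of `f` over `f '' w` with values in `w`. For `u'` orthogonal to `𝓐`, the
set `c '' (u' ∩ f '' w)` is orthogonal to `𝓑`, so it meets `w` in a finite set, and `f` maps that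
set onto `u' ∩ f '' w`. -/
theorem image_mem_of_mem_biorth {I J : Type*} {𝓐 : Set (Set I)} {𝓑 : Set (Set J)} {f : J → I}
    (h𝓑 : ∀ w ∈ 𝓑, f '' w ∈ 𝓐) {w : Set J} (hw : w ∈ finOrth (finOrth 𝓑)) :
    f '' w ∈ finOrth (finOrth 𝓐) := by
  intro u' hu'
  rcases w.eq_empty_or_nonempty with rfl | ⟨j, -⟩
  · simp
  have : Nonempty J := ⟨j⟩
  choose! c hc using fun (a : I) (ha : a ∈ f '' w) => ha
  have hA : c '' (u' ∩ f '' w) ∈ finOrth 𝓑 := by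
    intro t ht
    refine ((hu' _ (h𝓑 t ht)).image c).subset ?_
    rintro _ ⟨hmt, a, ha, rfl⟩
    exact ⟨a, ⟨⟨c a, hmt, (hc a ha.2).2⟩, ha.1⟩, rfl⟩
  refine ((hw _ hA).image f).subset fun a ha => ?_
  exact ⟨c a, ⟨⟨a, ha, rfl⟩, (hc a ha.2).1⟩, (hc a ha.2).2⟩

/-- Both projections of a generating rectangle are small, and smallness of images passes to the
biorthogonal. Hence rectangles alone give a base at `0` in `K⟨X ⊸ Y⟩`. -/
theorem exists_subset_prod_of_mem_finOrth_limpl {X : FinitenessSpace.{u}}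
    {Y : FinitenessSpace.{v}} {w : Set (X.limpl Y).Web} (hw : w ∈ finOrth (X.limpl Y).fin) :
    ∃ u ∈ X.fin, ∃ v' ∈ finOrth Y.fin, w ⊆ u ×ˢ v' := by
  refine ⟨Prod.fst '' w, ?_, Prod.snd '' w, ?_, fun p hp => ⟨⟨p, hp, rfl⟩, ⟨p, hp, rfl⟩⟩⟩
  · rw [← X.finOrth_finOrth]
    refine image_mem_of_mem_biorth ?_ hw
    rintro _ ⟨u, hu, v', -, rfl⟩
    exact X.mem_fin_of_subset (Set.fst_image_prod_subset _ _) hu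
  · rw [← finOrth_finOrth_finOrth]
    refine image_mem_of_mem_biorth ?_ hw
    rintro _ ⟨u, -, v', hv', rfl⟩
    exact Y.orth.mem_fin_of_subset (Set.snd_image_prod_subset _ _) hv'

theorem setOf_subset_mem_fin_excl {X : FinitenessSpace.{u}} {u : Set X.Web} (hu : u ∈ X.fin) :
    {m : Multiset X.Web | ∀ a ∈ m, a ∈ u} ∈ X.excl.fin :=
  X.mem_fin_of_subset (Set.iUnion₂_subset fun _ hm _ ha => hm _ ha) hu

theorem exists_forall_mem_of_mem_fin_excl {X : FinitenessSpace.{u}} {A : Set (Multiset X.Web)}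
    (hA : A ∈ X.excl.fin) : ∃ u ∈ X.fin, ∀ m ∈ A, ∀ a ∈ m, a ∈ u :=
  ⟨⋃ m ∈ A, {a | a ∈ m}, hA, fun m hm _ ha => Set.mem_iUnion₂.2 ⟨m, hm, ha⟩⟩

/-! ### Completeness, dense subspace and bounded subspaces of `K⟨X⟩` -/

namespace Vec

variable {K : Type w} [Field K] {X : FinitenessSpace.{u}}

@[ext]
theorem ext {x y : Vec K X} (h : ∀ a, x a = y a) : x = y := Subtype.ext (funext h)

theorem mem_neigh {u' : Set X.Web} {x : Vec K X} : x ∈ neigh K u' ↔ ∀ a ∈ u', x a = 0 := by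
  change Function.support x.1 ∩ u' = ∅ ↔ _
  rw [← Set.disjoint_iff_inter_eq_empty, Set.disjoint_right]
  simp

theorem support_mem_fin (x : Vec K X) : {a | x a ≠ 0} ∈ X.fin := x.2

theorem finite_support_inter (x : Vec K X) {u' : Set X.Web} (hu' : u' ∈ finOrth X.fin) :
    ({a | x a ≠ 0} ∩ u').Finite := hu' _ x.support_mem_fin

theorem nhds_hasBasis (x : Vec K X) :
    (𝓝 x).HasBasis (fun u' : Set X.Web => u' ∈ finOrth X.fin)
      (fun u' => {z | z - x ∈ neigh K u'}) := by
  refine (linTopology_nhds_hasBasis (basis K X) (basis_nonempty K X)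
    (basis_directed K X) x).to_hasBasis ?_ ?_
  · rintro _ ⟨u', hu', rfl⟩
    exact ⟨u', hu', subset_rfl⟩
  · exact fun u' hu' => ⟨_, ⟨u', hu', rfl⟩, subset_rfl⟩

theorem nhds_zero_hasBasis :
    (𝓝 (0 : Vec K X)).HasBasis (fun u' : Set X.Web => u' ∈ finOrth X.fin)
      (fun u' => (neigh K u' : Set (Vec K X))) := by
  simpa using nhds_hasBasis (0 : Vec K X)

theorem isOpen_neigh {u' : Set X.Web} (hu' : u' ∈ finOrth X.fin) :
    IsOpen (neigh K u' : Set (Vec K X)) :=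
  AddSubgroup.isOpen_of_mem_nhds (neigh K u' : Submodule K (Vec K X)).toAddSubgroup (g := 0) <|
    nhds_zero_hasBasis.mem_of_mem hu'

theorem exists_neigh_le {U : Submodule K (Vec K X)} (hU : IsOpen (U : Set (Vec K X))) :
    ∃ u' ∈ finOrth X.fin, neigh K u' ≤ U := by
  obtain ⟨u', hu', h⟩ := nhds_zero_hasBasis.mem_iff.1 (hU.mem_nhds U.zero_mem)
  exact ⟨u', hu', h⟩

theorem mem_finOrth_of_finite {s : Set X.Web} (hs : s.Finite) : s ∈ finOrth X.fin :=
  X.orth.mem_fin_of_finite hs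

instance : T2Space (Vec K X) := by
  refine IsTopologicalAddGroup.t2Space_of_zero_sep fun x hx => ?_
  obtain ⟨a, ha⟩ : ∃ a, x a ≠ 0 := by
    by_contra! h
    exact hx (ext h)
  refine ⟨_, (isOpen_neigh (K := K) (mem_finOrth_of_finite (Set.finite_singleton a))).mem_nhds
    (neigh K {a}).zero_mem, fun h => ha (mem_neigh.1 h a rfl)⟩

instance : UniformSpace (Vec K X) := IsTopologicalAddGroup.rightUniformSpace _

instance : IsUniformAddGroup (Vec K X) := isUniformAddGroup_of_addCommGroup

/-- Along a Cauchy filter the restriction to each `u' ∈ F(X)^⊥` is eventually constant. Singletons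
`u' = {a}` determine the coordinates of the limit. -/
instance : CompleteSpace (Vec K X) := by
  refine ⟨fun {f} hf => ?_⟩
  have hne := hf.1
  have hS : ∀ u' ∈ finOrth X.fin, ∃ S ∈ f, ∀ x ∈ S, ∀ y ∈ S, ∀ a ∈ u', x a = y a := by
    intro u' hu'
    have h0 : {p : Vec K X × Vec K X | p.2 - p.1 ∈ neigh K u'} ∈ uniformity (Vec K X) := by
      rw [uniformity_eq_comap_nhds_zero]
      exact ⟨_, (isOpen_neigh hu').mem_nhds (neigh K u').zero_mem, subset_rfl⟩
    obtain ⟨S, hSf, hSS⟩ := (cauchy_iff.1 hf).2 _ h0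
    refine ⟨S, hSf, fun x hx y hy a ha => ?_⟩
    have : y - x ∈ neigh K u' := hSS (Set.mk_mem_prod hx hy)
    exact (sub_eq_zero.1 (mem_neigh.1 this a ha)).symm
  choose! S hSf hS using hS
  have hex : ∀ a : X.Web, ∃ z : Vec K X, z ∈ S {a} := fun a =>
    Filter.nonempty_of_mem (hSf {a} (mem_finOrth_of_finite (Set.finite_singleton a)))
  choose z hz using hex
  have hlim : ∀ u' ∈ finOrth X.fin, ∀ y ∈ S u', ∀ a ∈ u', y a = z a a := by
    intro u' hu' y hy a ha
    have ha' := mem_finOrth_of_finite (X := X) (Set.finite_singleton a)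
    obtain ⟨t, ht, ht'⟩ := Filter.nonempty_of_mem (inter_mem (hSf u' hu') (hSf _ ha'))
    rw [hS u' hu' y hy t ht a ha, hS _ ha' t ht' (z a) (hz a) a rfl]
  -- On each `u'` the limit agrees with an actual vector of `K⟨X⟩`, whose support meets `u'` in a
  -- finite set.
  have hx : {a | z a a ≠ 0} ∈ X.fin := X.mem_fin_iff.2 fun u' hu' => by
    obtain ⟨y, hy⟩ := Filter.nonempty_of_mem (hSf u' hu')
    refine (y.finite_support_inter hu').subset ?_
    rintro a ⟨ha, h⟩
    refine ⟨?_, ha⟩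
    change y a ≠ 0
    rw [hlim u' hu' y hy a ha]
    exact h
  refine ⟨⟨fun a => z a a, hx⟩, (nhds_hasBasis _).ge_iff.2 fun u' hu' => ?_⟩
  refine mem_of_superset (hSf u' hu') fun y hy => mem_neigh.2 fun a ha => ?_
  exact sub_eq_zero.2 (hlim u' hu' y hy a ha)

variable (K) in
/-- The coordinate functionals. -/
def coord (a : X.Web) : Vec K X →ₗ[K] K := (LinearMap.proj a).comp (vecSubmodule K X).subtype

@[simp]
theorem coord_apply (a : X.Web) (x : Vec K X) : coord K a x = x a := rfl

@[simp]
theorem sub_apply (x y : Vec K X) (a : X.Web) : (x - y) a = x a - y a := rfl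

variable (K X) in
/-- The finitely supported families. -/
def ofFinsupp : (X.Web →₀ K) →ₗ[K] Vec K X where
  toFun f := ⟨f, X.mem_fin_of_finite f.hasFiniteSupport⟩
  map_add' _ _ := rfl
  map_smul' _ _ := rfl

@[simp]
theorem ofFinsupp_apply (f : X.Web →₀ K) (a : X.Web) : ofFinsupp K X f a = f a := rfl

theorem exists_finsupp_sub_mem_neigh (x : Vec K X) {u' : Set X.Web} (hu' : u' ∈ finOrth X.fin) :
    ∃ f : X.Web →₀ K, ofFinsupp K X f - x ∈ neigh K u' := by
  classical
  refine ⟨Finsupp.onFinset (x.finite_support_inter hu').toFinset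
    (fun a => if a ∈ u' then x a else 0) fun a ha => ?_, mem_neigh.2 fun a ha => ?_⟩
  · have h : a ∈ u' := by
      by_contra h
      exact ha (if_neg h)
    rw [if_pos h] at ha
    simpa using ⟨ha, h⟩
  · simp [ha]

theorem denseRange_ofFinsupp : DenseRange (ofFinsupp K X) := by
  intro x
  rw [mem_closure_iff_nhds_basis (nhds_hasBasis x)]
  intro u' hu'
  obtain ⟨f, hf⟩ := exists_finsupp_sub_mem_neigh x hu'
  exact ⟨_, ⟨f, rfl⟩, hf⟩

variable (K) in
/-- The vectors whose support is contained in `u`. -/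
def supportedIn (u : Set X.Web) : Submodule K (Vec K X) := neigh K uᶜ

theorem mem_supportedIn {u : Set X.Web} {x : Vec K X} :
    x ∈ supportedIn K u ↔ ∀ a ∉ u, x a = 0 := mem_neigh

/-- Truncation to the finite set `u ∩ u'`: this makes `supportedIn K u` bounded and later reduces
multilinear maps to finitely many coefficients. -/
theorem sub_sum_single_mem_neigh {u u' : Set X.Web} {s : Finset X.Web}
    (hs : (s : Set X.Web) = u ∩ u')
    {x : Vec K X} (hx : x ∈ supportedIn K u) :
    x - ∑ a ∈ s, x a • ofFinsupp K X (Finsupp.single a 1) ∈ neigh K u' := by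
  classical
  refine mem_neigh.2 fun b hb => ?_
  have h : coord K b (∑ a ∈ s, x a • ofFinsupp K X (Finsupp.single a 1)) =
      if b ∈ s then x b else 0 := by
    simp [Finsupp.single_apply]
  rw [sub_apply, ← coord_apply b (Finset.sum _ _), h]
  split_ifs with hbs
  · exact sub_self _
  · rw [mem_supportedIn.1 hx b fun hbu => hbs (Finset.mem_coe.1 (hs ▸ ⟨hbu, hb⟩)), sub_zero]

theorem linBounded_supportedIn {u : Set X.Web} (hu : u ∈ X.fin) :
    LinBounded (supportedIn K u) := by
  intro U hU
  obtain ⟨u', hu', h⟩ := exists_neigh_le hU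
  have hfin : (u ∩ u').Finite := hu' u hu
  have hle : (supportedIn K u).map U.mkQ ≤ Submodule.span K
      (U.mkQ '' ((fun a => ofFinsupp K X (Finsupp.single a 1)) '' (u ∩ u'))) := by
    rw [Submodule.span_image]
    rintro _ ⟨x, hx, rfl⟩
    refine ⟨∑ a ∈ hfin.toFinset, x a • ofFinsupp K X (Finsupp.single a 1),
      Submodule.sum_mem _ fun a ha => Submodule.smul_mem _ _
        (Submodule.subset_span ⟨a, hfin.mem_toFinset.1 ha, rfl⟩), ?_⟩
    exact ((Submodule.Quotient.eq U).2 (h (sub_sum_single_mem_neigh hfin.coe_toFinset hx))).symm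
  have := FiniteDimensional.span_of_finite K
    ((hfin.image fun a => ofFinsupp K X (Finsupp.single a 1)).image U.mkQ)
  exact Submodule.finiteDimensional_of_le hle

/-- The union of the supports of the vectors in `B` is finitary: modulo `neigh K u'` finitely many
vectors generate `B`, and a point of `u'` outside all their supports is outside the support of every
vector of `B`. -/
theorem exists_le_supportedIn {B : Submodule K (Vec K X)} (hB : LinBounded B) :
    ∃ u ∈ X.fin, B ≤ supportedIn K u := by
  refine ⟨{a | ∃ x ∈ B, x a ≠ 0}, X.mem_fin_iff.2 fun u' hu' => ?_, fun x hx =>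
    mem_supportedIn.2 fun a ha => ?_⟩
  · have hfd := hB _ (isOpen_neigh (K := K) hu')
    obtain ⟨s, hs⟩ := (Submodule.fg_iff_finiteDimensional _).2 hfd
    have hsB : ∀ y ∈ s, ∃ x ∈ B, (neigh K u').mkQ x = y := fun y hy =>
      (hs ▸ Submodule.subset_span hy : y ∈ B.map (neigh K u').mkQ)
    choose! c hcB hc using hsB
    refine (s.finite_toSet.biUnion fun y _ => (c y).finite_support_inter hu').subset ?_
    rintro a ⟨ha, x, hx, hxa⟩
    by_contra hcon
    have h0 : ∀ y ∈ s, c y a = 0 := fun y hy => by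
      by_contra h
      exact hcon (Set.mem_iUnion₂.2 ⟨y, hy, h, ha⟩)
    -- For `a ∈ u'` the coordinate at `a` descends to the quotient, so its vanishing can be tested
    -- on generators.
    let φ := (neigh K u').liftQ (coord K a) fun z hz => mem_neigh.1 hz a ha
    have hle : B.map (neigh K u').mkQ ≤ LinearMap.ker φ := by
      rw [← hs, Submodule.span_le]
      intro y hy
      rw [SetLike.mem_coe, LinearMap.mem_ker, ← hc y hy]
      exact h0 y hy
    exact hxa (LinearMap.mem_ker.1 (hle ⟨x, hx, rfl⟩))
  · by_contra h
    exact ha ⟨x, hx, h⟩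

end Vec

end FinitenessSpace

/-! ### Polynomial and hypocontinuous maps -/

section Pol

variable {K : Type u} [Field K] {E : Type v} [AddCommGroup E] [Module K E] [TopologicalSpace E]
  {F : Type w} [AddCommGroup F] [Module K F] [TopologicalSpace F]

namespace Pol

theorem ann_mono {B B' : Submodule K E} {V V' : Submodule K F} (hB : B ≤ B') (hV : V' ≤ V) :
    ann B' V' ≤ (ann B V : Submodule K (Pol K E F)) :=
  fun _ hf x hx => hV (hf x (hB hx))

variable (K E F) in
/-- Evaluation of polynomial maps at a point. -/
def evalAt (x : E) : Pol K E F →ₗ[K] F := (LinearMap.proj x).comp (polSubmodule K E F).subtype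

@[simp]
theorem evalAt_apply (x : E) (f : Pol K E F) : evalAt K E F x f = f x := rfl

theorem sub_apply (f g : Pol K E F) (x : E) : (f - g) x = f x - g x := rfl

theorem nhds_hasBasis (f : Pol K E F) :
    (𝓝 f).HasBasis (fun p : Submodule K E × Submodule K F => LinBounded p.1 ∧ IsOpen (p.2 : Set F))
      (fun p => {g | g - f ∈ ann p.1 p.2}) := by
  refine (linTopology_nhds_hasBasis (basis K E F) basis_nonempty basis_directed f).to_hasBasis ?_ ?_
  · rintro _ ⟨B, V, hB, hV, rfl⟩
    exact ⟨(B, V), ⟨hB, hV⟩, subset_rfl⟩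
  · exact fun p hp => ⟨_, ⟨p.1, p.2, hp.1, hp.2, rfl⟩, subset_rfl⟩

theorem nhds_zero_hasBasis : (𝓝 (0 : Pol K E F)).HasBasis
    (fun p : Submodule K E × Submodule K F => LinBounded p.1 ∧ IsOpen (p.2 : Set F))
      (fun p => (ann p.1 p.2 : Set (Pol K E F))) := by
  simpa using nhds_hasBasis (0 : Pol K E F)

end Pol

theorem IsPolynomialMap.of_multilinear {n : ℕ} {f : MultilinearMap K (fun _ : Fin n => E) F}
    (hf : Hypocontinuous f) : IsPolynomialMap K fun x => f fun _ => x := by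
  refine ⟨n, fun i => if h : n = i then h ▸ f else 0, fun i _ => ?_, fun x => ?_⟩
  · dsimp only
    split_ifs with h
    · subst h
      exact hf
    · exact Hypocontinuous.zero
  · rw [Finset.sum_eq_single n]
    · simp
    · intro i _ hi
      simp [hi.symm]
    · simp

/-- A multilinear map does not change modulo `V` if its arguments in a bounded subspace `B` are
modified by elements of a suitable open subspace. -/
theorem Hypocontinuous.exists_isOpen_sub_mem {n : ℕ}
    {f : MultilinearMap K (fun _ : Fin n => E) F} (hf : Hypocontinuous f) {B : Submodule K E}
    (hB : LinBounded B) {V : Submodule K F} (hV : IsOpen (V : Set F)) :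
    ∃ U : Submodule K E, IsOpen (U : Set E) ∧ ∀ x ∈ B, ∀ y ∈ B, x - y ∈ U →
      (f fun _ => x) - (f fun _ => y) ∈ V := by
  classical
  choose U hU h using fun i => hf i V hV (fun _ => B) fun _ _ => hB
  refine ⟨⨅ i, U i, ?_, fun x hx y hy hxy => ?_⟩
  · rw [Submodule.coe_iInf]
    exact isOpen_iInter_of_finite hU
  -- Replace `y` by `x` one slot at a time: each replacement changes the value by `f` with `x - y`
  -- in that slot and elements of `B` in the others.
  have key : ∀ s : Finset (Fin n),
      f (s.piecewise (fun _ => x) fun _ => y) - (f fun _ => y) ∈ V := by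
    intro s
    induction s using Finset.induction_on with
    | empty => simp
    | insert i s hi ih =>
      have hz : f (Function.update (s.piecewise (fun _ => x) fun _ => y) i (x - y)) ∈ V := by
        refine h i _ ?_ fun j hj => ?_
        · simpa using (Submodule.mem_iInf U).1 hxy i
        · rw [Function.update_of_ne hj]
          by_cases hjs : j ∈ s <;> simp [hjs, hx, hy]
      rw [f.map_update_sub] at hz
      have hy' : Function.update (s.piecewise (fun _ => x) fun _ => y) i y =
          s.piecewise (fun _ => x) fun _ => y := by
        rw [Function.update_eq_self_iff]
        simp [hi]
      rw [hy'] at hz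
      rw [Finset.piecewise_insert]
      simpa using V.add_mem hz ih
  simpa using key Finset.univ

end Pol

/-! ### Monomials and comparison of the two topologies -/

namespace FinitenessSpace

variable {K : Type w} [Field K] {X : FinitenessSpace.{u}} {Y : FinitenessSpace.{v}}

open Vec

variable (K) in
/-- The multilinear map `(x₁, …, xₙ) ↦ x₁ (a₁) ⋯ xₙ (aₙ) e_b`. -/
noncomputable def monomialMultilinear {n : ℕ} (a : Fin n → X.Web) (b : Y.Web) :
    MultilinearMap K (fun _ : Fin n => Vec K X) (Vec K Y) :=
  ((MultilinearMap.mkPiRing K (Fin n) (ofFinsupp K Y (Finsupp.single b 1))).compLinearMap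
    fun i => coord K (a i))

theorem monomialMultilinear_apply {n : ℕ} (a : Fin n → X.Web) (b : Y.Web)
    (x : Fin n → Vec K X) :
    monomialMultilinear K a b x = (∏ i, x i (a i)) • ofFinsupp K Y (Finsupp.single b 1) := by
  simp [monomialMultilinear]

theorem hypocontinuous_monomialMultilinear {n : ℕ} (a : Fin n → X.Web) (b : Y.Web) :
    Hypocontinuous (monomialMultilinear K a b) := by
  intro i V _ B _
  refine ⟨neigh K {a i}, isOpen_neigh (mem_finOrth_of_finite (Set.finite_singleton _)),
    fun x hx _ => ?_⟩
  rw [monomialMultilinear_apply,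
    Finset.prod_eq_zero (Finset.mem_univ i) (mem_neigh.1 hx (a i) rfl), zero_smul]
  exact V.zero_mem

variable (K) in
/-- The polynomial map `x ↦ x^m e_b`. -/
noncomputable def monomialMap (p : Multiset X.Web × Y.Web) : Pol K (Vec K X) (Vec K Y) :=
  ⟨fun x => (p.1.map fun a => x a).prod • ofFinsupp K Y (Finsupp.single p.2 1), by
    change IsPolynomialMap K _
    -- Any enumeration of the multiset serves, since only the diagonal values matter.
    convert IsPolynomialMap.of_multilinear
      (hypocontinuous_monomialMultilinear (K := K) p.1.toList.get p.2) using 1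
    ext1 x
    rw [monomialMultilinear_apply]
    congr 1
    conv_lhs => rw [← Multiset.coe_toList p.1]
    rw [Multiset.map_coe, Multiset.prod_coe, ← List.prod_ofFn]
    congr 1
    exact (List.ofFn_getElem_eq_map _ _).symm⟩

theorem monomialMap_apply (p : Multiset X.Web × Y.Web) (x : Vec K X) :
    monomialMap K p x =
      (p.1.map fun a => x a).prod • ofFinsupp K Y (Finsupp.single p.2 1) := rfl

variable (K X Y) in
/-- The polynomial map with a given finite family of coefficients. -/
noncomputable def polOfFinsupp : ((Multiset X.Web × Y.Web) →₀ K) →ₗ[K] Pol K (Vec K X) (Vec K Y) :=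
  Finsupp.linearCombination K (monomialMap K)

theorem polOfFinsupp_single_apply (p : Multiset X.Web × Y.Web) (c : K) (x : Vec K X) :
    polOfFinsupp K X Y (Finsupp.single p c) x =
      ((p.1.map fun a => x a).prod * c) • ofFinsupp K Y (Finsupp.single p.2 1) := by
  rw [polOfFinsupp, Finsupp.linearCombination_single, mul_comm, mul_smul]
  rfl

open scoped Classical in
theorem polOfFinsupp_apply_apply (M : (Multiset X.Web × Y.Web) →₀ K) (x : Vec K X) (b : Y.Web) :
    polOfFinsupp K X Y M x b =
      ∑ p ∈ M.support with p.2 = b, M p * (p.1.map fun a => x a).prod := by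
  have : polOfFinsupp K X Y M x b =
      ((coord K b).comp (Pol.evalAt K (Vec K X) (Vec K Y) x)) (polOfFinsupp K X Y M) := rfl
  rw [this, polOfFinsupp, Finsupp.linearCombination_apply, Finsupp.sum, map_sum, Finset.sum_filter]
  refine Finset.sum_congr rfl fun p _ => ?_
  simp [monomialMap_apply, Finsupp.single_apply]

/-- For fixed `b ∈ v'`, the coefficients at monomials in the variables from `u` form a polynomial
vanishing at every point, hence zero as `K` is infinite. All other monomials contain a variable
outside `u` and vanish on `supportedIn K u`. -/
theorem polOfFinsupp_mem_ann_iff [Infinite K] (M : (Multiset X.Web × Y.Web) →₀ K)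
    (u : Set X.Web) (hu : u ∈ X.fin) (v' : Set Y.Web) :
    polOfFinsupp K X Y M ∈ Pol.ann (supportedIn K u) (neigh K v') ↔
      ∀ p : Multiset X.Web × Y.Web, (∀ a ∈ p.1, a ∈ u) → p.2 ∈ v' → M p = 0 := by
  classical
  refine ⟨fun h => ?_, fun h x hx => mem_neigh.2 fun b hb => ?_⟩
  · rintro ⟨m, b⟩ hm hb
    let S := {p ∈ M.support | p.2 = b}.filter fun p => ∀ a ∈ p.1, a ∈ u
    let P : MvPolynomial X.Web K :=
      ∑ p ∈ S, MvPolynomial.monomial (Multiset.toFinsupp p.1) (M p)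
    have hP : P = 0 := by
      refine MvPolynomial.funext fun y => ?_
      -- Cutting an arbitrary point `y` down to `u` gives a vector of `K⟨X⟩` and does not change the
      -- value of `P`, whose variables all lie in `u`.
      let x : Vec K X := ⟨fun a => if a ∈ u then y a else 0,
        X.mem_fin_of_subset (fun a ha => by by_contra h; exact ha (if_neg h)) hu⟩
      have hxu : ∀ a ∈ u, x a = y a := fun a ha => if_pos ha
      have hxn : ∀ a ∉ u, x a = 0 := fun a ha => if_neg ha
      have h0 := mem_neigh.1 (h x (mem_supportedIn.2 hxn)) b hb
      rw [polOfFinsupp_apply_apply] at h0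
      rw [map_zero, ← h0, map_sum]
      refine (Finset.sum_congr rfl fun p hp => ?_).trans
        (Finset.sum_subset (Finset.filter_subset _ _) fun p hp hpS => ?_)
      · rw [MvPolynomial.eval_monomial, Finsupp.prod, Multiset.toFinsupp_support]
        rw [Multiset.map_congr rfl fun a ha => hxu a ((Finset.mem_filter.1 hp).2 a ha),
          Finset.prod_multiset_map_count]
        simp
      · obtain ⟨a, ha, hau⟩ : ∃ a ∈ p.1, a ∉ u := by
          by_contra! hcon
          exact hpS (Finset.mem_filter.2 ⟨hp, hcon⟩)
        rw [Multiset.prod_eq_zero (Multiset.mem_map.2 ⟨a, ha, hxn a hau⟩), mul_zero]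
    by_contra hM
    have hc : P.coeff (Multiset.toFinsupp m) = M (m, b) := by
      rw [MvPolynomial.coeff_sum, Finset.sum_eq_single (m, b)]
      · simp
      · rintro ⟨m', b'⟩ hp hne
        have hb' : b' = b := (Finset.mem_filter.1 (Finset.mem_filter.1 hp).1).2
        subst hb'
        rw [MvPolynomial.coeff_monomial, if_neg]
        intro h
        exact hne (congrArg (·, b') (Multiset.toFinsupp.injective h))
      · intro hS
        refine absurd ?_ hS
        exact Finset.mem_filter.2 ⟨Finset.mem_filter.2
          ⟨Finsupp.mem_support_iff.2 hM, rfl⟩, hm⟩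
    exact hM (by rw [← hc, hP, MvPolynomial.coeff_zero])
  · rw [polOfFinsupp_apply_apply]
    refine Finset.sum_eq_zero fun p hp => ?_
    obtain ⟨hpM, rfl⟩ := Finset.mem_filter.1 hp
    obtain ⟨a, ha, hau⟩ : ∃ a ∈ p.1, a ∉ u := by
      by_contra! hcon
      exact Finsupp.mem_support_iff.1 hpM (h p hcon hb)
    rw [Multiset.prod_eq_zero (Multiset.mem_map.2 ⟨a, ha, mem_supportedIn.1 hx a hau⟩), mul_zero]

/-- By cofinality only rectangles, subspaces `supportedIn K u` and neighbourhoods `neigh K v'` need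
be compared, and `polOfFinsupp_mem_ann_iff` matches them. -/
theorem comap_ofFinsupp_nhds_zero [Infinite K] :
    comap (ofFinsupp K (X.excl.limpl Y)) (𝓝 0) = comap (polOfFinsupp K X Y) (𝓝 0) := by
  refine le_antisymm ?_ ?_
  · refine ((Pol.nhds_zero_hasBasis (K := K) (E := Vec K X) (F := Vec K Y)).comap _).ge_iff.2 ?_
    rintro ⟨B, V⟩ ⟨hB, hV⟩
    obtain ⟨u, hu, hBu⟩ := exists_le_supportedIn hB
    obtain ⟨v', hv', hvV⟩ := exists_neigh_le hV
    refine mem_of_superset (((Vec.nhds_zero_hasBasis (K := K) (X := X.excl.limpl Y)).comap _).mem_of_mem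
      (prod_mem_finOrth_limpl (setOf_subset_mem_fin_excl hu) hv')) fun M hM => ?_
    refine Pol.ann_mono hBu hvV ((polOfFinsupp_mem_ann_iff M u hu v').2 fun p hp hpv => ?_)
    exact mem_neigh.1 hM p ⟨hp, hpv⟩
  · refine ((Vec.nhds_zero_hasBasis (K := K) (X := X.excl.limpl Y)).comap _).ge_iff.2 fun w hw => ?_
    obtain ⟨A, hA, v', hv', hwA⟩ := exists_subset_prod_of_mem_finOrth_limpl hw
    obtain ⟨u, hu, hAu⟩ := exists_forall_mem_of_mem_fin_excl hA
    refine mem_of_superset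
      (((Pol.nhds_zero_hasBasis (K := K) (E := Vec K X) (F := Vec K Y)).comap _).mem_of_mem
      (i := (supportedIn K u, neigh K v'))
      ⟨linBounded_supportedIn hu, isOpen_neigh hv'⟩) fun M hM => ?_
    refine mem_neigh.2 fun p hp => (polOfFinsupp_mem_ann_iff M u hu v').1 hM p ?_ (hwA hp).2
    exact hAu p.1 (hwA hp).1

/-! ### Density of the polynomials with finitely many coefficients -/

/-- Modulo an open subspace, a hypocontinuous multilinear map is on the diagonal of a bounded
subspace a polynomial with finitely many coefficients. -/
theorem exists_polOfFinsupp_sub_mem {n : ℕ}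
    {f : MultilinearMap K (fun _ : Fin n => Vec K X) (Vec K Y)} (hf : Hypocontinuous f)
    {u : Set X.Web} (hu : u ∈ X.fin) {v' : Set Y.Web} (hv' : v' ∈ finOrth Y.fin) :
    ∃ M, ∀ x ∈ supportedIn K u, polOfFinsupp K X Y M x - (f fun _ => x) ∈ neigh K v' := by
  classical
  obtain ⟨U, hU, hUf⟩ := hf.exists_isOpen_sub_mem (linBounded_supportedIn hu) (isOpen_neigh hv')
  obtain ⟨u', hu', hle⟩ := exists_neigh_le hU
  have hfin : (u ∩ u').Finite := hu' u hu
  let s := hfin.toFinset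
  let e : X.Web → Vec K X := fun a => ofFinsupp K X (Finsupp.single a 1)
  have hy : ∀ y : Vec K Y, ∃ g : Y.Web →₀ K, ofFinsupp K Y g - y ∈ neigh K v' := fun y =>
    exists_finsupp_sub_mem_neigh y hv'
  choose g hg using hy
  -- Expand `f` at the truncated vector over the words `r` in `s`, replacing each value on unit
  -- vectors by a finite family modulo `neigh K v'`. Words with the same underlying multiset simply
  -- add up their coefficients.
  let M : (Multiset X.Web × Y.Web) →₀ K := ∑ r ∈ Fintype.piFinset fun _ : Fin n => s,
    (g (f fun i => e (r i))).mapDomain fun b => (Finset.univ.val.map r, b)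
  have hsub : ∀ x ∈ supportedIn K u, x - ∑ a ∈ s, x a • e a ∈ neigh K u' := fun x hx =>
    sub_sum_single_mem_neigh hfin.coe_toFinset hx
  have hmem : ∀ x : Vec K X, ∑ a ∈ s, x a • e a ∈ supportedIn K u := by
    refine fun x => Submodule.sum_mem _ fun a ha => Submodule.smul_mem _ _ ?_
    refine mem_supportedIn.2 fun b hb => Finsupp.single_eq_of_ne ?_
    rintro rfl
    exact hb (hfin.mem_toFinset.1 ha).1
  have hM1 : ∀ (x : Vec K X) (r : Fin n → X.Web) (h : Y.Web →₀ K),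
      polOfFinsupp K X Y (h.mapDomain fun b => (Finset.univ.val.map r, b)) x =
        (∏ i, x (r i)) • ofFinsupp K Y h := by
    intro x r h
    induction h using Finsupp.induction_linear with
    | zero => simp; rfl
    | add h₁ h₂ ih₁ ih₂ =>
      rw [Finsupp.mapDomain_add, map_add, map_add, smul_add, ← ih₁, ← ih₂]
      rfl
    | single b c =>
      rw [Finsupp.mapDomain_single, polOfFinsupp_single_apply, mul_smul, ← map_smul]
      simp [List.prod_ofFn]
  refine ⟨M, fun x hx => ?_⟩
  -- The truncation of `x` stays in `supportedIn K u` and differs from `x` by an element of `U`.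
  have h1 := hUf x hx _ (hmem x) (hle (hsub x hx))
  have h2 : (f fun _ => ∑ a ∈ s, x a • e a) =
      ∑ r ∈ Fintype.piFinset fun _ : Fin n => s, (∏ i, x (r i)) • f fun i => e (r i) := by
    rw [f.map_sum_finset (fun _ a => x a • e a) fun _ => s]
    exact Finset.sum_congr rfl fun r _ => f.map_smul_univ _ _
  have h3 : polOfFinsupp K X Y M x = ∑ r ∈ Fintype.piFinset fun _ : Fin n => s,
      (∏ i, x (r i)) • ofFinsupp K Y (g (f fun i => e (r i))) := by
    rw [← Pol.evalAt_apply, map_sum, map_sum]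
    exact Finset.sum_congr rfl fun r _ => hM1 x r _
  have h4 : polOfFinsupp K X Y M x - (f fun _ => ∑ a ∈ s, x a • e a) ∈ neigh K v' := by
    rw [h2, h3, ← Finset.sum_sub_distrib]
    refine Submodule.sum_mem _ fun r _ => ?_
    rw [← smul_sub]
    exact Submodule.smul_mem _ _ (hg _)
  simpa using Submodule.sub_mem _ h4 h1

theorem denseRange_polOfFinsupp : DenseRange (polOfFinsupp K X Y) := by
  intro f
  rw [mem_closure_iff_nhds_basis (Pol.nhds_hasBasis f)]
  rintro ⟨B, V⟩ ⟨hB, hV⟩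
  obtain ⟨u, hu, hBu⟩ := exists_le_supportedIn hB
  obtain ⟨v', hv', hvV⟩ := exists_neigh_le hV
  obtain ⟨n, g, hg, hf⟩ := f.2
  -- Setting the components above degree `n` to zero makes all of them hypocontinuous, so that `M`
  -- can be chosen for every `i`.
  obtain ⟨g, hg, hf⟩ := IsPolynomialMap.exists_of_le hg hf le_rfl
  choose M hM using fun i => exists_polOfFinsupp_sub_mem (hg i) hu hv'
  refine ⟨_, ⟨∑ i ∈ Finset.range (n + 1), M i, rfl⟩, Pol.ann_mono hBu hvV fun x hx => ?_⟩
  rw [Pol.sub_apply, hf x, ← Pol.evalAt_apply, map_sum, map_sum, ← Finset.sum_sub_distrib]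
  exact Submodule.sum_mem _ fun i _ => hM i x hx

end FinitenessSpace

/-- Over an infinite field, `K⟨!X ⊸ Y⟩` is linearly homeomorphic to the completion of the space of
polynomial maps `K⟨X⟩ → K⟨Y⟩`. -/
theorem mainTheorem6 {K : Type w} [Field K] [Infinite K]
    (X : FinitenessSpace.{u}) (Y : FinitenessSpace.{v}) :
    Nonempty (FinitenessSpace.Vec K (X.excl.limpl Y) ≃L[K]
      Ana K (FinitenessSpace.Vec K X) (FinitenessSpace.Vec K Y)) :=
  nonempty_continuousLinearEquiv_completion _ _ FinitenessSpace.Vec.denseRange_ofFinsupp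
    FinitenessSpace.denseRange_polOfFinsupp FinitenessSpace.comap_ofFinsupp_nhds_zero
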